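/- Consider the system $x_{k+1}=A_{\mathrm{tr}}x_k+B_{\mathrm{tr}}u_k+w_k$, $k\in\mathbb N$, with $x_0=0$, $x_k,w_k\in\mathbb R^{n_x}$, $u_k\in\mathbb R^{n_u}$, and put $\phi_k=[x_k^\top,u_k^\top]^\top\in\mathbb R^{n_\phi}$, $n_\phi=n_x+n_u$, $n_\theta=n_xn_\phi$, $\theta_{\mathrm{tr}}=\mathrm{vec}([A_{\mathrm{tr}},B_{\mathrm{tr}}])\in\mathbb R^{n_\theta}$. Let $(\mathcal F_k)_{k\ge-1}$ be a filtration such that, for every $k\ge 0$, $\phi_k$ is $\mathcal F_{k-1}$-measurable, $w_k$ is $\mathcal F_k$-measurable, and $w_k$ is conditionally sub-Gaussian with mean zero and proxy variance $\sigma_w^2I_{n_x}$, $\sigma_w\ge 0$: $\mathbb E[w_k]=0$ and $\mathbb E[\exp(l^\top w_k)\mid\mathcal F_{k-1}]\le\exp(\sigma_w^2\|l\|^2/2)$ almost surely for every $l\in\mathbb R^{n_x}$. Suppose that $(\hat\theta_0-\theta_{\mathrm{tr}})^\top(D_0\otimes I_{n_x})(\hat\theta_0-\theta_{\mathrm{tr}})\le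 1$ for a given vector $\hat\theta_0\in\mathbb R^{n_\theta}$ and a given matrix $D_0\succ0$, and let $\bar\theta=\|\hat\theta_0\|+\|D_0^{-1/2}\|$ (Euclidean norm and largest singular value). Let $D_{\mathrm{des}}\succ0$, $\lambda>0$, $\delta>0$ and $T\in\mathbb N$, and set $$\Phi=[\phi_0,\dots,\phi_{T-1}],\qquad X=[x_1^\top,\dots,x_T^\top]^\top,\qquad \bar D_T=(\Phi\Phi^\top)\otimes I_{n_x}+\lambda I_{n_\theta},$$ $$\hat\theta_T=\bar D_T^{-1}(\Phi\otimes I_{n_x})X,\qquad C_1=4\sigma_w^2\Big(\log\frac{5^{2n_x}}{\delta^2}-n_\theta\log\lambda\Big).$$ Consider the condition $$\Phi\Phi^\top+\lambda I_{n_\phi}-\big(2C_1+8\sigma_w^2\log\det\bar D_T+2\lambda\bar\theta^2\big)D_{\mathrm{des}}\succeq 0\qquad(\ast)$$ and the exploration goal $$(\theta_{\mathrm{tr}}-\hat\theta_T)^\top(D_{\mathrm{des}}\otimes I_{n_x})(\theta_{\mathrm{tr}}-\hat\theta_T)\le 1.\qquad(\ast\ast)$$ Then, with probability at least $1-\delta$,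 $(\ast)$ implies $(\ast\ast)$; that is, the event that $(\ast)$ fails or $(\ast\ast)$ holds has probability at least $1-\delta$. In particular, if $\Phi$ satisfies $(\ast)$ almost surely, then $(\ast\ast)$ holds with probability at least $1-\delta$. -/

import Mathlib

open MeasureTheory Matrix
open scoped Kronecker MatrixOrder Matrix.Norms.L2Operator

noncomputable section

namespace TargetedExploration

/-- The random vector `X` is sub-Gaussian with mean `m` and proxy variance `S`, conditionally on the
sub-σ-algebra `𝓖`: `𝔼[exp (lᵀ (X - m)) | 𝓖] ≤ exp (‖l‖_S² / 2)` for every vector `l`, where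
`‖l‖_S² = lᵀ S l`. Integrability is stated so that the expectations are meaningful. -/
structure IsCondSubGaussian {Ω ι : Type*} [Fintype ι] (𝓖 : MeasurableSpace Ω)
    {mΩ : MeasurableSpace Ω} (μ : Measure Ω) (X : Ω → ι → ℝ) (m : ι → ℝ) (S : Matrix ι ι ℝ) :
    Prop where
  integrable_coord : ∀ i, Integrable (fun ω => X ω i) μ
  mean_eq : ∀ i, ∫ ω, X ω i ∂μ = m i
  integrable_exp : ∀ l : ι → ℝ, Integrable (fun ω => Real.exp (l ⬝ᵥ (X ω - m))) μ
  condExp_le : ∀ l : ι → ℝ,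
    ∀ᵐ ω ∂μ, (μ[fun ω' => Real.exp (l ⬝ᵥ (X ω' - m)) | 𝓖]) ω ≤ Real.exp (l ⬝ᵥ (S *ᵥ l) / 2)

/-- Indices of `φ = [xᵀ, uᵀ]ᵀ ∈ ℝ^{n_φ}`, `n_φ = n_x + n_u`. -/
abbrev PhiIdx (nx nu : ℕ) : Type := Fin nx ⊕ Fin nu

/-- Indices of parameter vectors `θ ∈ ℝ^{n_θ}`, `n_θ = n_x n_φ`: a pair (column, row) of the matrix
`[A, B]`, in the convention of `Matrix.vec` (stacking of columns) and of the Kronecker product. -/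
abbrev ThetaIdx (nx nu : ℕ) : Type := PhiIdx nx nu × Fin nx

/-- The parameter vector `vec [A, B]`. -/
def param {nx nu : ℕ} (A : Matrix (Fin nx) (Fin nx) ℝ) (B : Matrix (Fin nx) (Fin nu) ℝ) :
    ThetaIdx nx nu → ℝ :=
  vec (fromCols A B)

/-- `φ = [xᵀ, uᵀ]ᵀ`. -/
def phi {nx nu : ℕ} (x : Fin nx → ℝ) (u : Fin nu → ℝ) : PhiIdx nx nu → ℝ := Sum.elim x u

/-- The data matrix `Φ = [φ_0, …, φ_{T-1}]`. -/
def dataMatrix {nx nu : ℕ} (x : ℕ → Fin nx → ℝ) (u : ℕ → Fin nu → ℝ) (T : ℕ) :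
    Matrix (PhiIdx nx nu) (Fin T) ℝ :=
  Matrix.of fun j k => phi (x k) (u k) j

/-- The stacked successor states `X = [x_1ᵀ, …, x_Tᵀ]ᵀ`. -/
def stackedStates {nx : ℕ} (x : ℕ → Fin nx → ℝ) (T : ℕ) : Fin T × Fin nx → ℝ :=
  fun p => x (p.1 + 1) p.2

/-- The regularized excitation `D̄_T = (Φ Φᵀ) ⊗ I + lam I`. -/
def regExcitation {nx nu T : ℕ} (lam : ℝ) (Φ : Matrix (PhiIdx nx nu) (Fin T) ℝ) :
    Matrix (ThetaIdx nx nu) (ThetaIdx nx nu) ℝ :=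
  (Φ * Φᵀ) ⊗ₖ (1 : Matrix (Fin nx) (Fin nx) ℝ) + lam • 1

/-- The regularized least squares estimate `θ̂_T = D̄_T⁻¹ (Φ ⊗ I) X`. -/
def rlsEstimate {nx nu : ℕ} (lam : ℝ) (x : ℕ → Fin nx → ℝ) (u : ℕ → Fin nu → ℝ) (T : ℕ) :
    ThetaIdx nx nu → ℝ :=
  (regExcitation lam (dataMatrix x u T))⁻¹ *ᵥ
    ((dataMatrix x u T ⊗ₖ (1 : Matrix (Fin nx) (Fin nx) ℝ)) *ᵥ stackedStates x T)

/-- The quadratic form `vᵀ (D ⊗ I) v`. -/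
def kronForm {nx nu : ℕ} (D : Matrix (PhiIdx nx nu) (PhiIdx nx nu) ℝ) (v : ThetaIdx nx nu → ℝ) :
    ℝ :=
  v ⬝ᵥ ((D ⊗ₖ (1 : Matrix (Fin nx) (Fin nx) ℝ)) *ᵥ v)

/-- The prior parameter set `Θ₀ = {θ | (θ̂₀ - θ)ᵀ (D₀ ⊗ I) (θ̂₀ - θ) ≤ 1}`. -/
def priorSet {nx nu : ℕ} (θhat₀ : ThetaIdx nx nu → ℝ)
    (D₀ : Matrix (PhiIdx nx nu) (PhiIdx nx nu) ℝ) : Set (ThetaIdx nx nu → ℝ) :=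
  {θ | kronForm D₀ (θhat₀ - θ) ≤ 1}

/-- `θ̄ = ‖θ̂₀‖ + ‖D₀^{-1/2}‖`, with the Euclidean norm of the vector and the largest singular value
of the matrix; `D₀^{-1/2}` is the positive semidefinite square root of `D₀⁻¹`. -/
def thetaBar {nx nu : ℕ} (θhat₀ : ThetaIdx nx nu → ℝ)
    (D₀ : Matrix (PhiIdx nx nu) (PhiIdx nx nu) ℝ) : ℝ :=
  ‖WithLp.toLp 2 θhat₀‖ + ‖CFC.sqrt D₀⁻¹‖

/-- `C₁ = 4 σ² (log (5 ^ (2 n_x) / δ²) - n_θ log lam)`. -/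
def constC₁ (nx nu : ℕ) (σ lam δ : ℝ) : ℝ :=
  4 * σ ^ 2 *
    (Real.log ((5 : ℝ) ^ (2 * nx) / δ ^ 2) - ((nx * (nx + nu) : ℕ) : ℝ) * Real.log lam)

/-- The sufficient condition on the data matrix `Φ`:
`Φ Φᵀ + lam I - (2 C₁ + 8 σ² log det D̄_T + 2 lam θ̄²) D_des ⪰ 0`. -/
def SufficientCondition {nx nu T : ℕ} (σ lam δ : ℝ) (θhat₀ : ThetaIdx nx nu → ℝ)
    (D₀ Ddes : Matrix (PhiIdx nx nu) (PhiIdx nx nu) ℝ) (Φ : Matrix (PhiIdx nx nu) (Fin T) ℝ) :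
    Prop :=
  (Φ * Φᵀ + lam • (1 : Matrix (PhiIdx nx nu) (PhiIdx nx nu) ℝ)
    - (2 * constC₁ nx nu σ lam δ + 8 * σ ^ 2 * Real.log (regExcitation lam Φ).det
        + 2 * lam * thetaBar θhat₀ D₀ ^ 2) • Ddes).PosSemidef

/-- The exploration goal `(θ_tr - θ̂)ᵀ (D_des ⊗ I) (θ_tr - θ̂) ≤ 1`. -/
def ExplorationGoal {nx nu : ℕ} (Ddes : Matrix (PhiIdx nx nu) (PhiIdx nx nu) ℝ)
    (θtr θhat : ThetaIdx nx nu → ℝ) : Prop :=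
  kronForm Ddes (θtr - θhat) ≤ 1

end TargetedExploration

end

/-! Write `V` for the regularized excitation, `S` for the noise term and `e` for the estimation
error. The normal equations give `V e = lam θ - S`, so a parallelogram inequality in the `V`-norm
yields `eᵀVe ≤ 2 lam ‖θ‖² + 2 SᵀV⁻¹S` (`dotProduct_mulVec_le_of_mulVec_eq_sub`). The prior set
bounds `‖θ‖` by `thetaBar`, so the probabilistic content is a bound on `SᵀV⁻¹S`, although `V` is
itself random.

That bound is the method of mixtures. For fixed `v`, sub-Gaussianity makes `exp (vᵀS/σ - ‖(Φᵀ ⊗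
I)v‖²/2)` have mean at most one (`lintegral_prod_expFactor_le_one`). Integrating over `v` against
`exp (-lam ‖v‖²/2)` completes `V` in the exponent and gives a multiple of `exp (SᵀV⁻¹S/(2σ²)) / √det
V` (`mixture_eq`). Markov's inequality then gives `SᵀV⁻¹S ≤ σ² (log det V - n_θ log lam - 2 log δ)`
outside an event of probability at most `δ`.

On the good event the scalar in the sufficient condition dominates `eᵀVe`, and the matrix inequality
transfers the bound to `Ddes`. -/

noncomputable section

namespace TargetedExploration

/-! ### Gaussian integrals with a linear and a quadratic term. -/

section Quadratic

lemma transpose_eq_self_of_posDef {ι : Type*} {V : Matrix ι ι ℝ} (hV : V.PosDef) : Vᵀ = V := by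
  simpa [conjTranspose_eq_transpose_of_trivial] using hV.isHermitian.eq

variable {ι : Type*} [Fintype ι]

lemma dotProduct_mulVec_comm {V : Matrix ι ι ℝ} (hV : Vᵀ = V) (a b : ι → ℝ) :
    a ⬝ᵥ (V *ᵥ b) = b ⬝ᵥ (V *ᵥ a) := by
  rw [dotProduct_mulVec, ← mulVec_transpose, hV, dotProduct_comm]

/-- The unnormalized mass of the standard Gaussian measure. -/
def gaussianMass (ι : Type*) [Fintype ι] : ENNReal :=
  ∫⁻ v : ι → ℝ, ENNReal.ofReal (Real.exp (-(v ⬝ᵥ v / 2)))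

/-- The mass cancels from every comparison below, so its value is never needed, only that it is
finite and nonzero. -/
lemma gaussianMass_ne_top : gaussianMass ι ≠ ⊤ := by
  have h : Integrable (fun v : ι → ℝ => ∏ i, Real.exp (-(1 / 2) * v i ^ 2)) :=
    Integrable.fintype_prod fun _ => integrable_exp_neg_mul_sq (by norm_num)
  have h2 : (fun v : ι → ℝ => Real.exp (-(v ⬝ᵥ v / 2))) =
      fun v : ι → ℝ => ∏ i, Real.exp (-(1 / 2) * v i ^ 2) := by
    ext v
    rw [← Real.exp_sum, ← Finset.mul_sum, dotProduct]
    congr 1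
    simp only [pow_two]
    ring
  rw [← h2] at h
  have := h.lintegral_lt_top
  exact this.ne

lemma measurable_dotProduct_self : Measurable fun v : ι → ℝ => v ⬝ᵥ v := by
  unfold dotProduct
  fun_prop

lemma gaussianMass_ne_zero : gaussianMass ι ≠ 0 := by
  unfold gaussianMass
  have hm : Measurable fun v : ι → ℝ => ENNReal.ofReal (Real.exp (-(v ⬝ᵥ v / 2))) := by
    have := measurable_dotProduct_self (ι := ι)
    fun_prop
  rw [Ne, lintegral_eq_zero_iff hm]
  intro h
  have h' : ∀ᵐ v : ι → ℝ, False := by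
    filter_upwards [h] with v hv
    have : (0 : ℝ) < Real.exp (-(v ⬝ᵥ v / 2)) := Real.exp_pos _
    simp only [Pi.zero_apply, ENNReal.ofReal_eq_zero] at hv
    linarith
  have h0 : (volume : Measure (ι → ℝ)) = 0 := by
    rw [← ae_eq_bot]
    exact Filter.eventually_false_iff_eq_bot.1 h'
  exact NeZero.ne (volume : Measure (ι → ℝ)) h0

variable [DecidableEq ι]

lemma exists_transpose_mul_self_eq {V : Matrix ι ι ℝ} (hV : V.PosDef) :
    ∃ R : Matrix ι ι ℝ, Rᵀ = R ∧ R * R = V ∧ |R.det| = √V.det ∧ R.det ≠ 0 := by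
  have h1 : CFC.sqrt V * CFC.sqrt V = V := CFC.sqrt_mul_sqrt_self V hV.posSemidef.nonneg
  have h2 : V.det = (CFC.sqrt V).det * (CFC.sqrt V).det := by rw [← det_mul, h1]
  have h3 : (CFC.sqrt V).PosSemidef := nonneg_iff_posSemidef.1 (CFC.sqrt_nonneg V)
  refine ⟨CFC.sqrt V, ?_, h1, ?_, ?_⟩
  · simpa [conjTranspose_eq_transpose_of_trivial] using h3.isHermitian.eq
  · rw [h2, Real.sqrt_mul_self_eq_abs]
  · intro h0
    have := hV.det_pos
    simp [h2, h0] at this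

lemma mulVec_inv_mulVec_of_posDef {V : Matrix ι ι ℝ} (hV : V.PosDef) (s : ι → ℝ) :
    V *ᵥ (V⁻¹ *ᵥ s) = s := by
  rw [mulVec_mulVec, mul_nonsing_inv _ hV.det_pos.ne'.isUnit, one_mulVec]

/-- The maximizer of the left side is `V⁻¹ s`. Using the square root `R` prepares the linear
substitution that reduces to the standard Gaussian. -/
lemma complete_square {V R : Matrix ι ι ℝ} (hV : V.PosDef) (hR : Rᵀ = R) (hRV : R * R = V)
    (s v : ι → ℝ) :
    s ⬝ᵥ v - v ⬝ᵥ (V *ᵥ v) / 2 =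
      s ⬝ᵥ (V⁻¹ *ᵥ s) / 2 -
        (R *ᵥ (v + -(V⁻¹ *ᵥ s))) ⬝ᵥ (R *ᵥ (v + -(V⁻¹ *ᵥ s))) / 2 := by
  have key : ∀ y : ι → ℝ, (R *ᵥ y) ⬝ᵥ (R *ᵥ y) = y ⬝ᵥ (V *ᵥ y) := by
    intro y
    rw [← hRV, ← mulVec_mulVec, dotProduct_mulVec_comm hR y]
  have hs := mulVec_inv_mulVec_of_posDef hV s
  have hsymm := dotProduct_mulVec_comm (transpose_eq_self_of_posDef hV) (V⁻¹ *ᵥ s) v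
  rw [key, mulVec_add, mulVec_neg, hs]
  rw [hs] at hsymm
  simp only [add_dotProduct, dotProduct_add, neg_dotProduct, dotProduct_neg, hsymm]
  rw [dotProduct_comm s v, dotProduct_comm (V⁻¹ *ᵥ s) s]
  ring

lemma lintegral_comp_mulVec {R : Matrix ι ι ℝ} (hR : R.det ≠ 0) {f : (ι → ℝ) → ENNReal}
    (hf : Measurable f) :
    ∫⁻ v : ι → ℝ, f (R *ᵥ v) = ENNReal.ofReal |R.det|⁻¹ * ∫⁻ v : ι → ℝ, f v := by
  have h := Real.map_matrix_volume_pi_eq_smul_volume_pi hR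
  have hm : Measurable (toLin' R) := (LinearMap.continuous_on_pi _).measurable
  have h2 := lintegral_map (μ := (volume : Measure (ι → ℝ))) hf hm
  simp only [toLin'_apply] at h2
  rw [← h2, h, lintegral_smul_measure, smul_eq_mul, abs_inv]

lemma lintegral_exp_sub_quadratic {V : Matrix ι ι ℝ} (hV : V.PosDef) (s : ι → ℝ) :
    ∫⁻ v : ι → ℝ, ENNReal.ofReal (Real.exp (s ⬝ᵥ v - v ⬝ᵥ (V *ᵥ v) / 2)) =
      ENNReal.ofReal (Real.exp (s ⬝ᵥ (V⁻¹ *ᵥ s) / 2) * (√V.det)⁻¹) * gaussianMass ι := by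
  obtain ⟨R, hR, hRV, hdet, hne⟩ := exists_transpose_mul_self_eq hV
  have hm : Measurable fun v : ι → ℝ => ENNReal.ofReal (Real.exp (-(v ⬝ᵥ v / 2))) := by
    have := measurable_dotProduct_self (ι := ι)
    fun_prop
  simp_rw [complete_square hV hR hRV s, sub_eq_add_neg, Real.exp_add,
    ENNReal.ofReal_mul (Real.exp_pos _).le]
  rw [lintegral_const_mul' _ _ ENNReal.ofReal_ne_top,
    lintegral_add_right_eq_self (fun v : ι → ℝ =>
      ENNReal.ofReal (Real.exp (-((R *ᵥ v) ⬝ᵥ (R *ᵥ v) / 2)))) (-(V⁻¹ *ᵥ s)),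
    lintegral_comp_mulVec hne hm, hdet, mul_assoc]
  rfl

end Quadratic

/-! ### Exponential supermartingale, in the extended nonnegative reals. -/

section Supermartingale

variable {Ω ι : Type*} [Fintype ι] {m mΩ : MeasurableSpace Ω} {μ : Measure Ω}

/-- The exponential factor `exp (lᵀ w - σ² ‖l‖² / 2)`. -/
def expFactor (σ : ℝ) (l w : ι → ℝ) : ENNReal :=
  ENNReal.ofReal (Real.exp (l ⬝ᵥ w - σ ^ 2 * (l ⬝ᵥ l) / 2))

lemma measurable_expFactor {α : Type*} {mα : MeasurableSpace α} (σ : ℝ) {l w : α → ι → ℝ}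
    (hl : Measurable l) (hw : Measurable w) : Measurable fun a => expFactor σ (l a) (w a) := by
  unfold expFactor dotProduct
  fun_prop

lemma continuous_expFactor_left (σ : ℝ) (w : ι → ℝ) : Continuous fun l => expFactor σ l w := by
  refine ENNReal.continuous_ofReal.comp ?_
  unfold dotProduct
  fun_prop

variable [DecidableEq ι]

/-- The conditional bound says that the measure with density `expFactor σ l (w ·)` is dominated by
`μ` on `m`. Integrating an `m`-measurable `Y` against both trimmed measures needs no integrability
of `Y`. -/
lemma lintegral_mul_expFactor_const_le [IsFiniteMeasure μ] (hm : m ≤ mΩ)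
    {w : Ω → ι → ℝ} (hwm : Measurable w) {σ : ℝ}
    (hw : IsCondSubGaussian m μ w 0 (σ ^ 2 • (1 : Matrix ι ι ℝ)))
    (l : ι → ℝ) {Y : Ω → ENNReal} (hY : Measurable[m] Y) :
    ∫⁻ ω, Y ω * expFactor σ l (w ω) ∂μ ≤ ∫⁻ ω, Y ω ∂μ := by
  set g : Ω → ENNReal := fun ω => expFactor σ l (w ω) with hg
  have hgm : Measurable g := measurable_expFactor σ measurable_const hwm
  have hle : (μ.withDensity g).trim hm ≤ μ.trim hm := by
    refine @Measure.le_iff _ m _ _ |>.2 fun s hs => ?_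
    rw [trim_measurableSet_eq hm hs, trim_measurableSet_eq hm hs, withDensity_apply _ (hm s hs)]
    have hint := hw.integrable_exp l
    simp only [sub_zero] at hint
    have hexp : ∀ ω, g ω = ENNReal.ofReal (Real.exp (-(σ ^ 2 * (l ⬝ᵥ l) / 2))) *
        ENNReal.ofReal (Real.exp (l ⬝ᵥ w ω)) := by
      intro ω
      rw [hg, ← ENNReal.ofReal_mul (Real.exp_pos _).le, ← Real.exp_add]
      simp only [expFactor]
      ring_nf
    have h1 : ∫⁻ ω in s, ENNReal.ofReal (Real.exp (l ⬝ᵥ w ω)) ∂μ ≤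
        ENNReal.ofReal (Real.exp (σ ^ 2 * (l ⬝ᵥ l) / 2)) * μ s := by
      rw [← ofReal_integral_eq_lintegral_ofReal hint.integrableOn
        (ae_of_all _ fun _ => (Real.exp_pos _).le), ← setIntegral_condExp hm hint hs]
      have hc := hw.condExp_le l
      simp only [sub_zero, smul_mulVec, one_mulVec, dotProduct_smul, smul_eq_mul] at hc
      calc _ ≤ ENNReal.ofReal (∫ _ in s, Real.exp (σ ^ 2 * (l ⬝ᵥ l) / 2) ∂μ) := by
            refine ENNReal.ofReal_le_ofReal (integral_mono_ae integrable_condExp.integrableOn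
              (integrable_const _) (ae_restrict_of_ae hc))
        _ = _ := by
            rw [setIntegral_const, smul_eq_mul, mul_comm, ENNReal.ofReal_mul (Real.exp_pos _).le,
              ofReal_measureReal]
    simp_rw [hexp]
    rw [lintegral_const_mul' _ _ ENNReal.ofReal_ne_top]
    calc _ ≤ ENNReal.ofReal (Real.exp (-(σ ^ 2 * (l ⬝ᵥ l) / 2))) *
          (ENNReal.ofReal (Real.exp (σ ^ 2 * (l ⬝ᵥ l) / 2)) * μ s) := by gcongr
      _ = μ s := by
        rw [← mul_assoc, ← ENNReal.ofReal_mul (Real.exp_pos _).le, ← Real.exp_add]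
        simp
  calc ∫⁻ ω, Y ω * g ω ∂μ = ∫⁻ ω, Y ω ∂(μ.withDensity g) := by
        rw [lintegral_withDensity_eq_lintegral_mul _ hgm (hY.mono hm le_rfl)]
        simp [mul_comm]
    _ = ∫⁻ ω, Y ω ∂((μ.withDensity g).trim hm) := (lintegral_trim hm hY).symm
    _ ≤ ∫⁻ ω, Y ω ∂(μ.trim hm) := lintegral_mono' hle le_rfl
    _ = ∫⁻ ω, Y ω ∂μ := lintegral_trim hm hY

lemma lintegral_mul_expFactor_simpleFunc_le [IsFiniteMeasure μ]
    (hm : m ≤ mΩ) {w : Ω → ι → ℝ} (hwm : Measurable w) {σ : ℝ}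
    (hw : IsCondSubGaussian m μ w 0 (σ ^ 2 • (1 : Matrix ι ι ℝ)))
    (l : @SimpleFunc Ω m (ι → ℝ)) {Y : Ω → ENNReal} (hY : Measurable[m] Y) :
    ∫⁻ ω, Y ω * expFactor σ (l ω) (w ω) ∂μ ≤ ∫⁻ ω, Y ω ∂μ := by
  have hms : ∀ a, MeasurableSet[m] (l ⁻¹' {a}) := fun a => @SimpleFunc.measurableSet_fiber _ _ m l a
  have hYa : ∀ a, Measurable[m] ((l ⁻¹' {a}).indicator Y) := fun a => hY.indicator (hms a)
  have hsplit : ∀ F : (ι → ℝ) → ENNReal, ∀ ω,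
      Y ω * F (l ω) = ∑ a ∈ @SimpleFunc.range _ _ m l, (l ⁻¹' {a}).indicator Y ω * F a := by
    intro F ω
    rw [Finset.sum_eq_single (l ω)]
    · simp
    · intro b _ hb
      rw [Set.indicator_of_notMem (by simpa using hb.symm), zero_mul]
    · intro h
      exact absurd (@SimpleFunc.mem_range_self _ _ m l ω) h
  have hgm : ∀ a, Measurable fun ω => expFactor σ a (w ω) := fun a =>
    measurable_expFactor σ measurable_const hwm
  calc ∫⁻ ω, Y ω * expFactor σ (l ω) (w ω) ∂μ
      = ∑ a ∈ @SimpleFunc.range _ _ m l,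
          ∫⁻ ω, (l ⁻¹' {a}).indicator Y ω * expFactor σ a (w ω) ∂μ := by
        have hmeas : ∀ a, Measurable fun ω => (l ⁻¹' {a}).indicator Y ω * expFactor σ a (w ω) :=
          fun a => ((hYa a).mono hm le_rfl).mul (hgm a)
        rw [← lintegral_finsetSum _ fun a _ => hmeas a]
        exact lintegral_congr fun ω => hsplit (fun a => expFactor σ a (w ω)) ω
    _ ≤ ∑ a ∈ @SimpleFunc.range _ _ m l, ∫⁻ ω, (l ⁻¹' {a}).indicator Y ω ∂μ :=
        Finset.sum_le_sum fun a _ => lintegral_mul_expFactor_const_le hm hwm hw a (hYa a)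
    _ = ∫⁻ ω, Y ω ∂μ := by
        rw [← lintegral_finsetSum _ fun a _ => (hYa a).mono hm le_rfl]
        refine lintegral_congr fun ω => ?_
        simpa using (hsplit 1 ω).symm

/-- Approximate `l` by `m`-measurable simple functions, handled fibre by fibre, and apply Fatou.
Finiteness of `Y` makes multiplication by `Y ω` continuous. -/
lemma lintegral_mul_expFactor_le [IsFiniteMeasure μ]
    (hm : m ≤ mΩ) {w : Ω → ι → ℝ} (hwm : Measurable w) {σ : ℝ}
    (hw : IsCondSubGaussian m μ w 0 (σ ^ 2 • (1 : Matrix ι ι ℝ)))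
    {l : Ω → ι → ℝ} (hl : Measurable[m] l) {Y : Ω → ENNReal} (hY : Measurable[m] Y)
    (hYtop : ∀ ω, Y ω ≠ ⊤) :
    ∫⁻ ω, Y ω * expFactor σ (l ω) (w ω) ∂μ ≤ ∫⁻ ω, Y ω ∂μ := by
  have hls : StronglyMeasurable[m] l := hl.stronglyMeasurable
  have hlim : ∀ ω, Filter.Tendsto (fun n => Y ω * expFactor σ (hls.approx n ω) (w ω)) Filter.atTop
      (nhds (Y ω * expFactor σ (l ω) (w ω))) := fun ω =>
    ENNReal.Tendsto.const_mul (((continuous_expFactor_left σ (w ω)).tendsto _).comp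
      (hls.tendsto_approx ω)) (Or.inr (hYtop ω))
  have hmeas : ∀ n, Measurable fun ω => Y ω * expFactor σ (hls.approx n ω) (w ω) := fun n =>
    (hY.mono hm le_rfl).mul (measurable_expFactor σ
      ((@SimpleFunc.measurable _ _ m _ (hls.approx n)).mono hm le_rfl) hwm)
  calc ∫⁻ ω, Y ω * expFactor σ (l ω) (w ω) ∂μ
      = ∫⁻ ω, Filter.liminf (fun n => Y ω * expFactor σ (hls.approx n ω) (w ω)) Filter.atTop ∂μ :=
        lintegral_congr fun ω => ((hlim ω).liminf_eq).symm
    _ ≤ Filter.liminf (fun n => ∫⁻ ω, Y ω * expFactor σ (hls.approx n ω) (w ω) ∂μ)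
          Filter.atTop := lintegral_liminf_le hmeas
    _ ≤ Filter.liminf (fun _ : ℕ => ∫⁻ ω, Y ω ∂μ) Filter.atTop :=
        Filter.liminf_le_liminf (Filter.Eventually.of_forall fun n =>
          lintegral_mul_expFactor_simpleFunc_le hm hwm hw _ hY)
    _ = ∫⁻ ω, Y ω ∂μ := Filter.liminf_const _

lemma lintegral_prod_expFactor_le_one [IsProbabilityMeasure μ] {𝓕 : Filtration ℕ mΩ}
    {w l : ℕ → Ω → ι → ℝ} {σ : ℝ} (hw : ∀ k, Measurable[𝓕 (k + 1)] (w k))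
    (hl : ∀ k, Measurable[𝓕 k] (l k))
    (hsubG : ∀ k, IsCondSubGaussian (𝓕 k) μ (w k) 0 (σ ^ 2 • (1 : Matrix ι ι ℝ))) (T : ℕ) :
    ∫⁻ ω, ∏ k ∈ Finset.range T, expFactor σ (l k ω) (w k ω) ∂μ ≤ 1 := by
  have hmeas : ∀ T, Measurable[𝓕 T]
      fun ω => ∏ k ∈ Finset.range T, expFactor σ (l k ω) (w k ω) := by
    intro T
    refine Finset.measurable_prod _ fun k hk => ?_
    have hk' := Finset.mem_range.1 hk
    exact measurable_expFactor σ ((hl k).mono (𝓕.mono hk'.le) le_rfl)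
      ((hw k).mono (𝓕.mono hk') le_rfl)
  induction T with
  | zero => simp
  | succ T ih =>
    simp_rw [Finset.prod_range_succ]
    refine (lintegral_mul_expFactor_le (𝓕.le T) ((hw T).mono (𝓕.le _) le_rfl) (hsubG T) (hl T)
      (hmeas T) fun ω => ?_).trans ih
    exact ENNReal.prod_ne_top fun _ _ => ENNReal.ofReal_ne_top

end Supermartingale

/-! ### Determinant lower bound from a quadratic form bound. -/

section Determinant

variable {ι : Type*} [Fintype ι] [DecidableEq ι]

lemma posDef_smul_one {ι : Type*} [DecidableEq ι] {lam : ℝ} (hlam : 0 < lam) : (lam • (1 : Matrix ι ι ℝ)).PosDef :=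
  PosDef.one.smul hlam

lemma det_smul_one (lam : ℝ) :
    (lam • (1 : Matrix ι ι ℝ)).det = lam ^ Fintype.card ι := by
  rw [det_smul, det_one, mul_one]

lemma lintegral_exp_neg_mul_dotProduct_self {lam : ℝ} (hlam : 0 < lam) :
    ∫⁻ v : ι → ℝ, ENNReal.ofReal (Real.exp (-(lam * (v ⬝ᵥ v) / 2))) =
      ENNReal.ofReal (√(lam ^ Fintype.card ι))⁻¹ * gaussianMass ι := by
  have h := lintegral_exp_sub_quadratic (posDef_smul_one (ι := ι) hlam) 0
  simpa [smul_mulVec, det_smul_one] using h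

/-- A larger quadratic form has a smaller Gaussian integral, and that integral is proportional to
`(det V)^{-1/2}`; no eigenvalues are needed. -/
lemma pow_card_le_det {V : Matrix ι ι ℝ} (hV : V.PosDef) {lam : ℝ} (hlam : 0 < lam)
    (h : ∀ v : ι → ℝ, lam * (v ⬝ᵥ v) ≤ v ⬝ᵥ (V *ᵥ v)) : lam ^ Fintype.card ι ≤ V.det := by
  have h1 := lintegral_exp_sub_quadratic hV 0
  have h2 := lintegral_exp_neg_mul_dotProduct_self (ι := ι) hlam
  have hle : ENNReal.ofReal (√V.det)⁻¹ * gaussianMass ι ≤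
      ENNReal.ofReal (√(lam ^ Fintype.card ι))⁻¹ * gaussianMass ι := by
    rw [← h2]
    simp only [zero_dotProduct, zero_div, Real.exp_zero, one_mul, zero_sub] at h1
    rw [← h1]
    refine lintegral_mono fun v => ENNReal.ofReal_le_ofReal (Real.exp_le_exp.2 ?_)
    have := h v
    linarith
  have hpow : 0 < lam ^ Fintype.card ι := pow_pos hlam _
  rw [ENNReal.mul_le_mul_iff_left gaussianMass_ne_zero gaussianMass_ne_top,
    ENNReal.ofReal_le_ofReal_iff (by positivity),
    inv_le_inv₀ (Real.sqrt_pos.2 hV.det_pos) (Real.sqrt_pos.2 hpow),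
    Real.sqrt_le_sqrt_iff hV.det_pos.le] at hle
  exact hle

end Determinant

/-! ### Deterministic analysis of the least squares error. -/

section Regression

variable {nx nu T : ℕ}

lemma transpose_kronecker_mulVec_apply (Φ : Matrix (PhiIdx nx nu) (Fin T) ℝ)
    (v : ThetaIdx nx nu → ℝ) (k : Fin T) (i : Fin nx) :
    ((Φᵀ ⊗ₖ (1 : Matrix (Fin nx) (Fin nx) ℝ)) *ᵥ v) (k, i) = ∑ p, Φ p k * v (p, i) := by
  simp [mulVec, dotProduct, Fintype.sum_prod_type, one_apply]

lemma mul_transpose_kronecker (Φ : Matrix (PhiIdx nx nu) (Fin T) ℝ) :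
    (Φ * Φᵀ) ⊗ₖ (1 : Matrix (Fin nx) (Fin nx) ℝ) =
      (Φ ⊗ₖ (1 : Matrix (Fin nx) (Fin nx) ℝ)) * (Φᵀ ⊗ₖ (1 : Matrix (Fin nx) (Fin nx) ℝ)) := by
  rw [← mul_kronecker_mul, one_mul]

lemma dotProduct_kronecker_mulVec (Φ : Matrix (PhiIdx nx nu) (Fin T) ℝ)
    (v : ThetaIdx nx nu → ℝ) (W : Fin T × Fin nx → ℝ) :
    v ⬝ᵥ ((Φ ⊗ₖ (1 : Matrix (Fin nx) (Fin nx) ℝ)) *ᵥ W) = ((Φᵀ ⊗ₖ 1) *ᵥ v) ⬝ᵥ W := by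
  have h : Φᵀ ⊗ₖ (1 : Matrix (Fin nx) (Fin nx) ℝ) = (Φ ⊗ₖ 1)ᵀ := by
    rw [← kroneckerMap_transpose, transpose_one]
  rw [h, mulVec_transpose, dotProduct_mulVec]

lemma dotProduct_regExcitation_mulVec (lam : ℝ) (Φ : Matrix (PhiIdx nx nu) (Fin T) ℝ)
    (v : ThetaIdx nx nu → ℝ) :
    v ⬝ᵥ (regExcitation lam Φ *ᵥ v) =
      ((Φᵀ ⊗ₖ (1 : Matrix (Fin nx) (Fin nx) ℝ)) *ᵥ v) ⬝ᵥ ((Φᵀ ⊗ₖ 1) *ᵥ v) +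
        lam * (v ⬝ᵥ v) := by
  rw [regExcitation, mul_transpose_kronecker, add_mulVec, dotProduct_add, ← mulVec_mulVec,
    dotProduct_kronecker_mulVec, smul_mulVec, one_mulVec, dotProduct_smul, smul_eq_mul]

lemma zero_le_dotProduct_self {α : Type*} [Fintype α] (v : α → ℝ) : 0 ≤ v ⬝ᵥ v :=
  Finset.sum_nonneg fun i _ => mul_self_nonneg (v i)

lemma le_dotProduct_regExcitation_mulVec (lam : ℝ) (Φ : Matrix (PhiIdx nx nu) (Fin T) ℝ)
    (v : ThetaIdx nx nu → ℝ) : lam * (v ⬝ᵥ v) ≤ v ⬝ᵥ (regExcitation lam Φ *ᵥ v) := by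
  rw [dotProduct_regExcitation_mulVec]
  linarith [zero_le_dotProduct_self ((Φᵀ ⊗ₖ (1 : Matrix (Fin nx) (Fin nx) ℝ)) *ᵥ v)]

lemma posDef_regExcitation {lam : ℝ} (hlam : 0 < lam) (Φ : Matrix (PhiIdx nx nu) (Fin T) ℝ) :
    (regExcitation lam Φ).PosDef := by
  have h : (Φ * Φᵀ).PosSemidef := by
    simpa [conjTranspose_eq_transpose_of_trivial] using posSemidef_self_mul_conjTranspose Φ
  exact (posDef_smul_one hlam).posSemidef_add (h.kronecker PosSemidef.one)

lemma card_thetaIdx : Fintype.card (ThetaIdx nx nu) = nx * (nx + nu) := by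
  simp [mul_comm]

lemma mul_log_le_log_det_regExcitation {lam : ℝ} (hlam : 0 < lam)
    (Φ : Matrix (PhiIdx nx nu) (Fin T) ℝ) :
    ((nx * (nx + nu) : ℕ) : ℝ) * Real.log lam ≤ Real.log (regExcitation lam Φ).det := by
  rw [← Real.log_pow, ← card_thetaIdx]
  exact Real.log_le_log (pow_pos hlam _) (pow_card_le_det (posDef_regExcitation hlam Φ) hlam
    (le_dotProduct_regExcitation_mulVec lam Φ))

lemma stackedStates_eq {A : Matrix (Fin nx) (Fin nx) ℝ} {B : Matrix (Fin nx) (Fin nu) ℝ}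
    {x : ℕ → Fin nx → ℝ} {u : ℕ → Fin nu → ℝ} {w : ℕ → Fin nx → ℝ}
    (hx : ∀ k, x (k + 1) = A *ᵥ x k + B *ᵥ u k + w k) (T : ℕ) :
    stackedStates x T = ((dataMatrix x u T)ᵀ ⊗ₖ (1 : Matrix (Fin nx) (Fin nx) ℝ)) *ᵥ param A B +
      fun p => w p.1 p.2 := by
  ext ⟨k, i⟩
  rw [Pi.add_apply, transpose_kronecker_mulVec_apply, Fintype.sum_sum_type]
  simp [stackedStates, hx, dataMatrix, phi, param, vec, mulVec, dotProduct, mul_comm]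

/-- The noise term `S_T = (Φ ⊗ I) [w_0ᵀ, …, w_{T-1}ᵀ]ᵀ` of the least squares estimate. -/
def noiseTerm (x : ℕ → Fin nx → ℝ) (u : ℕ → Fin nu → ℝ) (w : ℕ → Fin nx → ℝ) (T : ℕ) :
    ThetaIdx nx nu → ℝ :=
  (dataMatrix x u T ⊗ₖ (1 : Matrix (Fin nx) (Fin nx) ℝ)) *ᵥ fun p => w p.1 p.2

lemma regExcitation_mulVec_error {A : Matrix (Fin nx) (Fin nx) ℝ} {B : Matrix (Fin nx) (Fin nu) ℝ}
    {x : ℕ → Fin nx → ℝ} {u : ℕ → Fin nu → ℝ} {w : ℕ → Fin nx → ℝ}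
    (hx : ∀ k, x (k + 1) = A *ᵥ x k + B *ᵥ u k + w k) (T : ℕ) {lam : ℝ} (hlam : 0 < lam) :
    regExcitation lam (dataMatrix x u T) *ᵥ (param A B - rlsEstimate lam x u T) =
      lam • param A B - noiseTerm x u w T := by
  rw [mulVec_sub, rlsEstimate, mulVec_inv_mulVec_of_posDef (posDef_regExcitation hlam _),
    stackedStates_eq hx, mulVec_add, mulVec_mulVec, ← mul_transpose_kronecker, regExcitation,
    add_mulVec, smul_mulVec, one_mulVec, noiseTerm]
  abel

lemma dotProduct_mulVec_nonneg_of_posDef {ι : Type*} [Fintype ι] {V : Matrix ι ι ℝ}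
    (hV : V.PosSemidef) (y : ι → ℝ) : 0 ≤ y ⬝ᵥ (V *ᵥ y) := by
  simpa using hV.dotProduct_mulVec_nonneg y

lemma dotProduct_mulVec_le_of_mulVec_eq_sub {ι : Type*} [Fintype ι] [DecidableEq ι]
    {V : Matrix ι ι ℝ} (hV : V.PosDef) {lam : ℝ} (hlam : 0 < lam)
    (h : ∀ v : ι → ℝ, lam * (v ⬝ᵥ v) ≤ v ⬝ᵥ (V *ᵥ v)) {e θ s : ι → ℝ}
    (he : V *ᵥ e = lam • θ - s) :
    e ⬝ᵥ (V *ᵥ e) ≤ 2 * lam * (θ ⬝ᵥ θ) + 2 * (s ⬝ᵥ (V⁻¹ *ᵥ s)) := by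
  set y := V⁻¹ *ᵥ θ with hy
  set z := V⁻¹ *ᵥ s with hz
  have hVy : V *ᵥ y = θ := mulVec_inv_mulVec_of_posDef hV θ
  have hVz : V *ᵥ z = s := mulVec_inv_mulVec_of_posDef hV s
  have hyV := h y
  rw [hVy] at hyV
  have hsq := zero_le_dotProduct_self (θ - lam • y)
  have hcross := dotProduct_mulVec_comm (transpose_eq_self_of_posDef hV) y z
  rw [hVy, hVz] at hcross
  have hee : e = lam • y - z := by
    have : V⁻¹ *ᵥ (V *ᵥ e) = e := by
      rw [mulVec_mulVec, nonsing_inv_mul _ hV.det_pos.ne'.isUnit, one_mulVec]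
    rw [← this, he, mulVec_sub, mulVec_smul]
  -- Since `e = lam y - z`, nonnegativity at `lam y + z` gives `eᵀVe ≤ 2 lam² yᵀVy + 2 zᵀVz`.
  have hpar := dotProduct_mulVec_nonneg_of_posDef hV.posSemidef (lam • y + z)
  rw [he, hee]
  rw [mulVec_add, mulVec_smul, hVy, hVz] at hpar
  simp only [add_dotProduct, dotProduct_add, sub_dotProduct, dotProduct_sub, smul_dotProduct,
    dotProduct_smul, smul_eq_mul] at *
  rw [dotProduct_comm θ y] at hsq
  rw [dotProduct_comm s z]
  -- This is `lam V⁻¹ ≤ I` tested at `θ`: expand `‖θ - lam y‖² ≥ 0` and use `lam ‖y‖² ≤ yᵀθ`.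
  have hlamy : lam * (y ⬝ᵥ θ) ≤ θ ⬝ᵥ θ := by nlinarith
  nlinarith

lemma kronForm_eq_sum (D : Matrix (PhiIdx nx nu) (PhiIdx nx nu) ℝ) (v : ThetaIdx nx nu → ℝ) :
    kronForm D v = ∑ i, (fun p => v (p, i)) ⬝ᵥ (D *ᵥ fun p => v (p, i)) := by
  have h : ∀ p i, ((D ⊗ₖ (1 : Matrix (Fin nx) (Fin nx) ℝ)) *ᵥ v) (p, i) =
      (D *ᵥ fun q => v (q, i)) p := by
    intro p i
    simp [mulVec, dotProduct, Fintype.sum_prod_type, one_apply]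
  simp only [kronForm, dotProduct, Fintype.sum_prod_type, h]
  exact Finset.sum_comm

lemma norm_toLp_sq {ι : Type*} [Fintype ι] (v : ι → ℝ) : ‖WithLp.toLp 2 v‖ ^ 2 = v ⬝ᵥ v := by
  rw [EuclideanSpace.norm_sq_eq]
  simp [dotProduct, pow_two]

/-- With `P = D^{-1/2}` and `y = P D v`, one has `v = P y` and `‖y‖² = vᵀDv`. -/
lemma dotProduct_self_le_norm_sqrt_inv {κ : Type*} [Fintype κ] [DecidableEq κ]
    {D : Matrix κ κ ℝ} (hD : D.PosDef) (v : κ → ℝ) :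
    v ⬝ᵥ v ≤ ‖CFC.sqrt D⁻¹‖ ^ 2 * (v ⬝ᵥ (D *ᵥ v)) := by
  set P := CFC.sqrt D⁻¹ with hP
  have hPP : P * P = D⁻¹ := CFC.sqrt_mul_sqrt_self _ hD.inv.posSemidef.nonneg
  have hPs : Pᵀ = P := by
    have h3 : P.PosSemidef := nonneg_iff_posSemidef.1 (CFC.sqrt_nonneg _)
    simpa [conjTranspose_eq_transpose_of_trivial] using h3.isHermitian.eq
  set y := P *ᵥ (D *ᵥ v) with hy
  have hPy : P *ᵥ y = v := by
    rw [hy, mulVec_mulVec, hPP, mulVec_mulVec, nonsing_inv_mul _ hD.det_pos.ne'.isUnit, one_mulVec]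
  have hyy : y ⬝ᵥ y = v ⬝ᵥ (D *ᵥ v) := by
    nth_rewrite 2 [hy]
    rw [dotProduct_mulVec_comm hPs, hPy, dotProduct_comm]
  have hn := P.l2_opNorm_mulVec (WithLp.toLp 2 y)
  change ‖WithLp.toLp 2 (P *ᵥ y)‖ ≤ _ at hn
  rw [hPy] at hn
  rw [← hyy, ← norm_toLp_sq v, ← norm_toLp_sq y, ← mul_pow]
  exact pow_le_pow_left₀ (norm_nonneg _) hn 2

lemma dotProduct_self_le_thetaBar_sq {θhat₀ θ : ThetaIdx nx nu → ℝ}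
    {D₀ : Matrix (PhiIdx nx nu) (PhiIdx nx nu) ℝ} (hD₀ : D₀.PosDef) (hθ : θ ∈ priorSet θhat₀ D₀) :
    θ ⬝ᵥ θ ≤ thetaBar θhat₀ D₀ ^ 2 := by
  have h1 : (θhat₀ - θ) ⬝ᵥ (θhat₀ - θ) ≤ ‖CFC.sqrt D₀⁻¹‖ ^ 2 := by
    calc (θhat₀ - θ) ⬝ᵥ (θhat₀ - θ)
        = ∑ i, (fun p => (θhat₀ - θ) (p, i)) ⬝ᵥ (fun p => (θhat₀ - θ) (p, i)) := by
          simp only [dotProduct, Fintype.sum_prod_type]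
          exact Finset.sum_comm
      _ ≤ ∑ i, ‖CFC.sqrt D₀⁻¹‖ ^ 2 *
            ((fun p => (θhat₀ - θ) (p, i)) ⬝ᵥ (D₀ *ᵥ fun p => (θhat₀ - θ) (p, i))) :=
          Finset.sum_le_sum fun i _ => dotProduct_self_le_norm_sqrt_inv hD₀ _
      _ = ‖CFC.sqrt D₀⁻¹‖ ^ 2 * kronForm D₀ (θhat₀ - θ) := by
          rw [kronForm_eq_sum, Finset.mul_sum]
      _ ≤ ‖CFC.sqrt D₀⁻¹‖ ^ 2 := mul_le_of_le_one_right (by positivity) hθ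
  rw [← norm_toLp_sq] at h1 ⊢
  have h2 := abs_le_of_sq_le_sq h1 (norm_nonneg _)
  refine pow_le_pow_left₀ (norm_nonneg _) ?_ 2
  have h3 : WithLp.toLp 2 θ = WithLp.toLp 2 θhat₀ - WithLp.toLp 2 (θhat₀ - θ) := by
    ext i
    simp
  rw [h3, thetaBar]
  exact (norm_sub_le _ _).trans (by gcongr; exact (abs_le.1 (by simpa using h2)).2)

lemma regExcitation_eq_kronecker (lam : ℝ) (Φ : Matrix (PhiIdx nx nu) (Fin T) ℝ) :
    regExcitation lam Φ = (Φ * Φᵀ + lam • (1 : Matrix (PhiIdx nx nu) (PhiIdx nx nu) ℝ)) ⊗ₖ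
      (1 : Matrix (Fin nx) (Fin nx) ℝ) := by
  rw [regExcitation, add_kronecker, smul_kronecker, one_kronecker_one]

/-- The sign of `β` is not assumed: for `v ≠ 0` it is forced by definiteness of `G`, and then `β
kronForm D v ≤ kronForm G v ≤ β`. -/
lemma kronForm_le_one_of_posSemidef_sub {D G : Matrix (PhiIdx nx nu) (PhiIdx nx nu) ℝ} {β : ℝ}
    {v : ThetaIdx nx nu → ℝ} (h : (G - β • D).PosSemidef) (hv : kronForm G v ≤ β)
    (hG : ∀ v : ThetaIdx nx nu → ℝ, v ≠ 0 → 0 < kronForm G v) : kronForm D v ≤ 1 := by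
  rcases eq_or_ne v 0 with rfl | hv0
  · simp [kronForm]
  have hβ : 0 < β := (hG v hv0).trans_le hv
  have hnn : 0 ≤ kronForm (G - β • D) v := by
    rw [kronForm_eq_sum]
    exact Finset.sum_nonneg fun i _ => dotProduct_mulVec_nonneg_of_posDef h _
  have hsub : kronForm (G - β • D) v = kronForm G v - β * kronForm D v := by
    simp only [kronForm_eq_sum, sub_mulVec, smul_mulVec, dotProduct_sub, dotProduct_smul,
      smul_eq_mul, Finset.sum_sub_distrib, Finset.mul_sum]
  nlinarith

lemma explorationGoal_of_noiseTerm_le {A : Matrix (Fin nx) (Fin nx) ℝ}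
    {B : Matrix (Fin nx) (Fin nu) ℝ}
    {x : ℕ → Fin nx → ℝ} {u : ℕ → Fin nu → ℝ} {w : ℕ → Fin nx → ℝ}
    (hx : ∀ k, x (k + 1) = A *ᵥ x k + B *ᵥ u k + w k) {T : ℕ} {lam : ℝ} (hlam : 0 < lam)
    {σ δ : ℝ} (hδ : 0 < δ) (hδ1 : δ ≤ 1)
    {θhat₀ : ThetaIdx nx nu → ℝ} {D₀ Ddes : Matrix (PhiIdx nx nu) (PhiIdx nx nu) ℝ}
    (hD₀ : D₀.PosDef) (hprior : param A B ∈ priorSet θhat₀ D₀)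
    (hnoise : noiseTerm x u w T ⬝ᵥ
        ((regExcitation lam (dataMatrix x u T))⁻¹ *ᵥ noiseTerm x u w T) ≤
      σ ^ 2 * (Real.log (regExcitation lam (dataMatrix x u T)).det -
        ((nx * (nx + nu) : ℕ) : ℝ) * Real.log lam - 2 * Real.log δ))
    (hsuff : SufficientCondition σ lam δ θhat₀ D₀ Ddes (dataMatrix x u T)) :
    ExplorationGoal Ddes (param A B) (rlsEstimate lam x u T) := by
  set V := regExcitation lam (dataMatrix x u T) with hVdef
  have hV : V.PosDef := posDef_regExcitation hlam _
  have herr := dotProduct_mulVec_le_of_mulVec_eq_sub hV hlam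
    (le_dotProduct_regExcitation_mulVec lam _) (regExcitation_mulVec_error hx T hlam)
  have hθ := dotProduct_self_le_thetaBar_sq hD₀ hprior
  have hlog := mul_log_le_log_det_regExcitation hlam (dataMatrix x u T)
  have hlogδ : Real.log δ ≤ 0 := Real.log_nonpos hδ.le hδ1
  have hform : ∀ v, kronForm (dataMatrix x u T * (dataMatrix x u T)ᵀ +
      lam • (1 : Matrix (PhiIdx nx nu) (PhiIdx nx nu) ℝ)) v = v ⬝ᵥ (V *ᵥ v) := by
    intro v
    rw [kronForm, ← regExcitation_eq_kronecker]
  refine kronForm_le_one_of_posSemidef_sub hsuff ?_ fun v hv => ?_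
  · rw [hform]
    refine herr.trans ?_
    have hC : constC₁ nx nu σ lam δ = 4 * σ ^ 2 * (2 * nx * Real.log 5 - 2 * Real.log δ -
        ((nx * (nx + nu) : ℕ) : ℝ) * Real.log lam) := by
      rw [constC₁, Real.log_div (by positivity) (by positivity), Real.log_pow, Real.log_pow]
      push_cast
      ring
    rw [hC]
    have h5 : 0 ≤ 2 * (nx : ℝ) * Real.log 5 := by
      have := Real.log_nonneg (show (1 : ℝ) ≤ 5 by norm_num)
      positivity
    have hb : lam * (param A B ⬝ᵥ param A B) ≤ lam * thetaBar θhat₀ D₀ ^ 2 := by gcongr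
    have hσ2 : 0 ≤ σ ^ 2 := sq_nonneg σ
    set L := Real.log V.det - ((nx * (nx + nu) : ℕ) : ℝ) * Real.log lam - 2 * Real.log δ with hL
    have hL0 : 0 ≤ σ ^ 2 * L := mul_nonneg hσ2 (by linarith)
    have h50 : 0 ≤ σ ^ 2 * (2 * (nx : ℝ) * Real.log 5) := mul_nonneg hσ2 h5
    -- The condition supplies `8σ²L` plus a `log 5` term, while the noise costs only `2σ²L`; the
    -- surplus is nonnegative because `log det V ≥ n_θ log lam` and `δ ≤ 1`.
    linear_combination 2 * hb + 2 * hnoise + 6 * hL0 + 8 * h50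
  · rw [hform]
    simpa using hV.dotProduct_mulVec_pos hv

end Regression

/-! ### Degenerate noise. -/

section Noise

variable {Ω ι : Type*} [Fintype ι] [DecidableEq ι] {m mΩ : MeasurableSpace Ω} {μ : Measure Ω}

/-- Testing along `± e_i` gives each coordinate a mean `cosh` of at most one, whereas `cosh > 1`
away from zero. This covers `σ = 0`, where the mixture cannot be rescaled by `σ⁻¹`. -/
lemma ae_eq_zero_of_isCondSubGaussian_zero [IsProbabilityMeasure μ] (hm : m ≤ mΩ) {w : Ω → ι → ℝ}
    (hw : IsCondSubGaussian m μ w 0 (0 : Matrix ι ι ℝ)) : ∀ᵐ ω ∂μ, w ω = 0 := by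
  have hle : ∀ l : ι → ℝ, ∫ ω, Real.exp (l ⬝ᵥ w ω) ∂μ ≤ 1 := by
    intro l
    have hc := hw.condExp_le l
    simp only [sub_zero, zero_mulVec, dotProduct_zero, zero_div, Real.exp_zero] at hc
    rw [← integral_condExp hm]
    calc _ ≤ ∫ _, (1 : ℝ) ∂μ := integral_mono_ae integrable_condExp (integrable_const _) hc
      _ = 1 := by simp
  have hint : ∀ l : ι → ℝ, Integrable (fun ω => Real.exp (l ⬝ᵥ w ω)) μ := by
    intro l
    simpa using hw.integrable_exp l
  have hcoord : ∀ i, ∀ᵐ ω ∂μ, w ω i = 0 := by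
    intro i
    have h1 := hle (Pi.single i 1)
    have h2 := hle (Pi.single i (-1))
    have i1 := hint (Pi.single i 1)
    have i2 := hint (Pi.single i (-1))
    simp only [single_dotProduct, one_mul, neg_one_mul] at h1 h2 i1 i2
    have hf : Integrable (fun ω => Real.exp (w ω i) + Real.exp (-w ω i) - 2) μ :=
      (i1.add i2).sub (integrable_const _)
    have hcosh : ∀ ω, Real.exp (w ω i) + Real.exp (-w ω i) - 2 =
        2 * (Real.cosh (w ω i) - 1) := by
      intro ω
      rw [Real.cosh_eq]
      ring
    have hnn : ∀ ω, 0 ≤ Real.exp (w ω i) + Real.exp (-w ω i) - 2 := by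
      intro ω
      rw [hcosh]
      linarith [Real.one_le_cosh (w ω i)]
    have hI : ∫ ω, (Real.exp (w ω i) + Real.exp (-w ω i) - 2) ∂μ = 0 := by
      refine le_antisymm ?_ (integral_nonneg hnn)
      have hi := integral_sub (i1.add i2) (integrable_const (μ := μ) (2 : ℝ))
      simp only [Pi.add_apply] at hi
      rw [hi, integral_add i1 i2]
      simp only [integral_const, probReal_univ, one_smul]
      linarith
    filter_upwards [(integral_eq_zero_iff_of_nonneg hnn hf).1 hI] with ω hω
    by_contra h0
    have := Real.one_lt_cosh.2 h0
    simp only [Pi.zero_apply] at hω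
    rw [hcosh] at hω
    linarith
  filter_upwards [ae_all_iff.2 hcoord] with ω hω
  exact funext hω

end Noise

/-! ### Method of mixtures and the self-normalized tail bound. -/

section SelfNormalized

variable {nx nu : ℕ}

lemma dotProduct_fin_prod {T : ℕ} (a b : Fin T × Fin nx → ℝ) :
    a ⬝ᵥ b = ∑ k, (fun i => a (k, i)) ⬝ᵥ (fun i => b (k, i)) := by
  simp only [dotProduct, Fintype.sum_prod_type]

/-- The direction `c V φ`, where `V` is the matrix with vectorization `v`. -/
def direction (c : ℝ) (v : ThetaIdx nx nu → ℝ) (φ : PhiIdx nx nu → ℝ) : Fin nx → ℝ :=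
  fun i => c * ∑ p, φ p * v (p, i)

lemma measurable_direction {α : Type*} {mα : MeasurableSpace α} (c : ℝ)
    {v : α → ThetaIdx nx nu → ℝ} {φ : α → PhiIdx nx nu → ℝ} (hv : Measurable v)
    (hφ : Measurable φ) : Measurable fun a => direction c (v a) (φ a) := by
  unfold direction
  fun_prop

lemma prod_expFactor_direction (σ c : ℝ) (x : ℕ → Fin nx → ℝ) (u : ℕ → Fin nu → ℝ)
    (w : ℕ → Fin nx → ℝ) (T : ℕ) (v : ThetaIdx nx nu → ℝ) :
    ∏ k ∈ Finset.range T, expFactor σ (direction c v (phi (x k) (u k))) (w k) =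
      ENNReal.ofReal (Real.exp (c * (noiseTerm x u w T ⬝ᵥ v) - σ ^ 2 * c ^ 2 *
        ((((dataMatrix x u T)ᵀ ⊗ₖ (1 : Matrix (Fin nx) (Fin nx) ℝ)) *ᵥ v) ⬝ᵥ
          (((dataMatrix x u T)ᵀ ⊗ₖ (1 : Matrix (Fin nx) (Fin nx) ℝ)) *ᵥ v)) / 2)) := by
  have hdir : ∀ k : Fin T, direction c v (phi (x k) (u k)) =
      c • fun i => (((dataMatrix x u T)ᵀ ⊗ₖ (1 : Matrix (Fin nx) (Fin nx) ℝ)) *ᵥ v) (k, i) := by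
    intro k
    ext i
    rw [Pi.smul_apply, transpose_kronecker_mulVec_apply]
    rfl
  simp only [expFactor]
  rw [← ENNReal.ofReal_prod_of_nonneg fun _ _ => (Real.exp_pos _).le, ← Real.exp_sum,
    Finset.sum_range, dotProduct_comm _ v, noiseTerm, dotProduct_kronecker_mulVec,
    dotProduct_fin_prod, dotProduct_fin_prod, Finset.mul_sum, Finset.mul_sum, Finset.sum_div,
    ← Finset.sum_sub_distrib]
  congr 2
  refine Finset.sum_congr rfl fun k _ => ?_
  rw [hdir]
  simp only [smul_dotProduct, dotProduct_smul, smul_eq_mul]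
  ring

/-- The mixture of the exponential supermartingales over a Gaussian weight with precision `lam`. -/
def mixture (σ lam : ℝ) (x : ℕ → Fin nx → ℝ) (u : ℕ → Fin nu → ℝ) (w : ℕ → Fin nx → ℝ)
    (T : ℕ) : ENNReal :=
  ∫⁻ v : ThetaIdx nx nu → ℝ,
    (∏ k ∈ Finset.range T, expFactor σ (direction σ⁻¹ v (phi (x k) (u k))) (w k)) *
      ENNReal.ofReal (Real.exp (-(lam * (v ⬝ᵥ v) / 2)))

/-- The scale `σ⁻¹` in the direction cancels the proxy variance, so the quadratic terms add up to
exactly `vᵀVv`. -/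
lemma mixture_eq {σ lam : ℝ} (hσ : 0 < σ) (hlam : 0 < lam) (x : ℕ → Fin nx → ℝ)
    (u : ℕ → Fin nu → ℝ) (w : ℕ → Fin nx → ℝ) (T : ℕ) :
    mixture σ lam x u w T =
      ENNReal.ofReal (Real.exp ((σ ^ 2)⁻¹ * (noiseTerm x u w T ⬝ᵥ
          ((regExcitation lam (dataMatrix x u T))⁻¹ *ᵥ noiseTerm x u w T)) / 2) *
        (√(regExcitation lam (dataMatrix x u T)).det)⁻¹) * gaussianMass (ThetaIdx nx nu) := by
  have h := lintegral_exp_sub_quadratic (posDef_regExcitation hlam (dataMatrix x u T))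
    (σ⁻¹ • noiseTerm x u w T)
  have hs : (σ⁻¹ • noiseTerm x u w T) ⬝ᵥ
      ((regExcitation lam (dataMatrix x u T))⁻¹ *ᵥ (σ⁻¹ • noiseTerm x u w T)) =
      (σ ^ 2)⁻¹ * (noiseTerm x u w T ⬝ᵥ
          ((regExcitation lam (dataMatrix x u T))⁻¹ *ᵥ noiseTerm x u w T)) := by
    rw [mulVec_smul, smul_dotProduct, dotProduct_smul, smul_eq_mul, smul_eq_mul, ← mul_assoc]
    congr 1
    rw [sq, mul_inv]
  rw [hs] at h
  rw [← h, mixture]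
  refine lintegral_congr fun v => ?_
  rw [prod_expFactor_direction, ← ENNReal.ofReal_mul (Real.exp_pos _).le, ← Real.exp_add,
    dotProduct_regExcitation_mulVec, smul_dotProduct, smul_eq_mul]
  congr 2
  field_simp
  ring

variable {Ω : Type*} {mΩ : MeasurableSpace Ω} {μ : Measure Ω} {𝓕 : Filtration ℕ mΩ}
  {x : ℕ → Ω → Fin nx → ℝ} {u : ℕ → Ω → Fin nu → ℝ} {w : ℕ → Ω → Fin nx → ℝ}

lemma measurable_mixture_integrand
    (hφ : ∀ k, Measurable fun ω => phi (x k ω) (u k ω)) (hw : ∀ k, Measurable (w k))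
    (σ lam : ℝ) (T : ℕ) :
    Measurable fun q : Ω × (ThetaIdx nx nu → ℝ) =>
      (∏ k ∈ Finset.range T,
        expFactor σ (direction σ⁻¹ q.2 (phi (x k q.1) (u k q.1))) (w k q.1)) *
      ENNReal.ofReal (Real.exp (-(lam * (q.2 ⬝ᵥ q.2) / 2))) := by
  refine Measurable.mul (Finset.measurable_prod _ fun k _ => measurable_expFactor σ
    (measurable_direction _ measurable_snd ((hφ k).comp measurable_fst))
    ((hw k).comp measurable_fst)) ?_
  have h : Measurable fun q : Ω × (ThetaIdx nx nu → ℝ) => q.2 ⬝ᵥ q.2 :=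
    measurable_dotProduct_self.comp measurable_snd
  fun_prop

lemma measurable_mixture
    (hφ : ∀ k, Measurable fun ω => phi (x k ω) (u k ω)) (hw : ∀ k, Measurable (w k))
    (σ lam : ℝ) (T : ℕ) :
    Measurable fun ω => mixture σ lam (fun k => x k ω) (fun k => u k ω) (fun k => w k ω) T :=
  (measurable_mixture_integrand hφ hw σ lam T).lintegral_prod_right'

/-- By Tonelli the expectation can be taken first, at fixed `v`, where the supermartingale bound
applies. -/
lemma lintegral_mixture_le [IsProbabilityMeasure μ]
    (hφ : ∀ k, Measurable[𝓕 k] fun ω => phi (x k ω) (u k ω))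
    (hw : ∀ k, Measurable[𝓕 (k + 1)] (w k)) {σ : ℝ}
    (hsubG : ∀ k, IsCondSubGaussian (𝓕 k) μ (w k) 0 (σ ^ 2 • (1 : Matrix (Fin nx) (Fin nx) ℝ)))
    {lam : ℝ} (hlam : 0 < lam) (T : ℕ) :
    ∫⁻ ω, mixture σ lam (fun k => x k ω) (fun k => u k ω) (fun k => w k ω) T ∂μ ≤
      ENNReal.ofReal (√(lam ^ Fintype.card (ThetaIdx nx nu)))⁻¹ *
        gaussianMass (ThetaIdx nx nu) := by
  have hφ' : ∀ k, Measurable fun ω => phi (x k ω) (u k ω) := fun k => (hφ k).mono (𝓕.le k) le_rfl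
  have hw' : ∀ k, Measurable (w k) := fun k => (hw k).mono (𝓕.le _) le_rfl
  rw [← lintegral_exp_neg_mul_dotProduct_self hlam]
  unfold mixture
  rw [lintegral_lintegral_swap (measurable_mixture_integrand hφ' hw' σ lam T).aemeasurable]
  refine lintegral_mono fun v => ?_
  rw [lintegral_mul_const' _ _ ENNReal.ofReal_ne_top]
  refine mul_le_of_le_one_left' ?_
  exact lintegral_prod_expFactor_le_one hw
    (fun k => measurable_direction σ⁻¹ measurable_const (hφ k)) hsubG T

/-- Self-normalized tail bound for the noise term of the regularized least squares estimate. -/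
lemma measure_lt_noiseTerm_le_of_pos [IsProbabilityMeasure μ]
    (hφ : ∀ k, Measurable[𝓕 k] fun ω => phi (x k ω) (u k ω))
    (hw : ∀ k, Measurable[𝓕 (k + 1)] (w k)) {σ : ℝ} (hσ : 0 < σ)
    (hsubG : ∀ k, IsCondSubGaussian (𝓕 k) μ (w k) 0 (σ ^ 2 • (1 : Matrix (Fin nx) (Fin nx) ℝ)))
    {lam : ℝ} (hlam : 0 < lam) {δ : ℝ} (hδ : 0 < δ) (T : ℕ) :
    μ {ω | σ ^ 2 * (Real.log (regExcitation lam
          (dataMatrix (fun k => x k ω) (fun k => u k ω) T)).det -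
        ((nx * (nx + nu) : ℕ) : ℝ) * Real.log lam - 2 * Real.log δ) <
      noiseTerm (fun k => x k ω) (fun k => u k ω) (fun k => w k ω) T ⬝ᵥ
        ((regExcitation lam (dataMatrix (fun k => x k ω) (fun k => u k ω) T))⁻¹ *ᵥ
          noiseTerm (fun k => x k ω) (fun k => u k ω) (fun k => w k ω) T)} ≤
      ENNReal.ofReal δ := by
  have hφ' : ∀ k, Measurable fun ω => phi (x k ω) (u k ω) := fun k => (hφ k).mono (𝓕.le k) le_rfl
  have hw' : ∀ k, Measurable (w k) := fun k => (hw k).mono (𝓕.le _) le_rfl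
  set n := Fintype.card (ThetaIdx nx nu) with hn
  set K : ENNReal := ENNReal.ofReal (√(lam ^ n))⁻¹ * gaussianMass (ThetaIdx nx nu) with hK
  have hpow : 0 < lam ^ n := pow_pos hlam _
  have hsqrt : 0 < √(lam ^ n) := Real.sqrt_pos.2 hpow
  have hK0 : K ≠ 0 := mul_ne_zero (by simpa using hsqrt) gaussianMass_ne_zero
  have hKtop : K ≠ ⊤ := ENNReal.mul_ne_top ENNReal.ofReal_ne_top gaussianMass_ne_top
  -- Markov at level `K / δ`, where `K` bounds the mean of the mixture. Taking logarithms below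
  -- turns this level into the stated threshold.
  have hmarkov := (mul_meas_ge_le_lintegral (μ := μ) (measurable_mixture hφ' hw' σ lam T)
    (ENNReal.ofReal δ⁻¹ * K)).trans (lintegral_mixture_le hφ hw hsubG hlam T)
  have hbound : μ {ω | ENNReal.ofReal δ⁻¹ * K ≤
      mixture σ lam (fun k => x k ω) (fun k => u k ω) (fun k => w k ω) T} ≤ ENNReal.ofReal δ := by
    rw [mul_comm (ENNReal.ofReal δ⁻¹), mul_assoc] at hmarkov
    have h1 : ENNReal.ofReal δ⁻¹ * μ {ω | K * ENNReal.ofReal δ⁻¹ ≤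
        mixture σ lam (fun k => x k ω) (fun k => u k ω) (fun k => w k ω) T} ≤ 1 := by
      rw [← ENNReal.mul_le_mul_iff_right hK0 hKtop, mul_one]
      exact hmarkov
    rw [mul_comm (ENNReal.ofReal δ⁻¹) K]
    rw [ENNReal.ofReal_inv_of_pos hδ] at h1 ⊢
    rw [mul_comm, ← div_eq_mul_inv] at h1
    exact (ENNReal.div_le_iff (by simpa using hδ) ENNReal.ofReal_ne_top).1 h1 |>.trans
      (by rw [one_mul])
  refine (measure_mono fun ω hω => ?_).trans hbound
  simp only [Set.mem_ofPred_eq] at hω ⊢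
  rw [mixture_eq hσ hlam, hK, ← mul_assoc, ← ENNReal.ofReal_mul (by positivity)]
  gcongr ENNReal.ofReal ?_ * _
  set V := regExcitation lam (dataMatrix (fun k => x k ω) (fun k => u k ω) T) with hVdef
  set q := noiseTerm (fun k => x k ω) (fun k => u k ω) (fun k => w k ω) T ⬝ᵥ (V⁻¹ *ᵥ
    noiseTerm (fun k => x k ω) (fun k => u k ω) (fun k => w k ω) T)
  have hV : 0 < V.det := (posDef_regExcitation hlam _).det_pos
  have hVs : 0 < √V.det := Real.sqrt_pos.2 hV
  rw [← Real.log_le_log_iff (by positivity) (by positivity), Real.log_mul (by positivity)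
    (by positivity), Real.log_mul (by positivity) (by positivity), Real.log_inv, Real.log_inv,
    Real.log_inv, Real.log_exp, Real.log_sqrt hpow.le, Real.log_sqrt hV.le, Real.log_pow, hn,
    card_thetaIdx]
  have hq : Real.log V.det - ((nx * (nx + nu) : ℕ) : ℝ) * Real.log lam - 2 * Real.log δ <
      (σ ^ 2)⁻¹ * q := by
    rw [inv_mul_eq_div, lt_div_iff₀ (by positivity), mul_comm]
    exact hω
  linarith

lemma measure_lt_noiseTerm_le [IsProbabilityMeasure μ]
    (hφ : ∀ k, Measurable[𝓕 k] fun ω => phi (x k ω) (u k ω))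
    (hw : ∀ k, Measurable[𝓕 (k + 1)] (w k)) {σ : ℝ} (hσ : 0 ≤ σ)
    (hsubG : ∀ k, IsCondSubGaussian (𝓕 k) μ (w k) 0 (σ ^ 2 • (1 : Matrix (Fin nx) (Fin nx) ℝ)))
    {lam : ℝ} (hlam : 0 < lam) {δ : ℝ} (hδ : 0 < δ) (T : ℕ) :
    μ {ω | σ ^ 2 * (Real.log (regExcitation lam
          (dataMatrix (fun k => x k ω) (fun k => u k ω) T)).det -
        ((nx * (nx + nu) : ℕ) : ℝ) * Real.log lam - 2 * Real.log δ) <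
      noiseTerm (fun k => x k ω) (fun k => u k ω) (fun k => w k ω) T ⬝ᵥ
        ((regExcitation lam (dataMatrix (fun k => x k ω) (fun k => u k ω) T))⁻¹ *ᵥ
          noiseTerm (fun k => x k ω) (fun k => u k ω) (fun k => w k ω) T)} ≤
      ENNReal.ofReal δ := by
  rcases hσ.eq_or_lt with rfl | hpos
  · have hzero : ∀ᵐ ω ∂μ, ∀ k, w k ω = 0 := ae_all_iff.2 fun k =>
      ae_eq_zero_of_isCondSubGaussian_zero (𝓕.le k) (by simpa using hsubG k)
    refine le_of_eq_of_le (measure_eq_zero_iff_ae_notMem.2 ?_) zero_le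
    filter_upwards [hzero] with ω hω
    have h : noiseTerm (fun k => x k ω) (fun k => u k ω) (fun k => w k ω) T = 0 := by
      have : (fun p : Fin T × Fin nx => w p.1 ω p.2) = 0 := by
        ext p
        simp [hω]
      rw [noiseTerm, this, mulVec_zero]
    simp [h]
  · exact measure_lt_noiseTerm_le_of_pos hφ hw hpos hsubG hlam hδ T

/-- Subadditivity on `s ∪ t = univ` avoids any measurability of `s` or `t`. -/
lemma one_sub_le_measureReal_of_compl_subset [IsProbabilityMeasure μ] {s t : Set Ω} {δ : ℝ}
    (hδ : 0 ≤ δ) (hs : μ s ≤ ENNReal.ofReal δ) (hst : sᶜ ⊆ t) : 1 - δ ≤ μ.real t := by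
  have h1 : μ.real s ≤ δ := ENNReal.toReal_le_of_le_ofReal hδ hs
  have h2 : μ.real (s ∪ t) = 1 := by
    have : s ∪ t = Set.univ := Set.compl_subset_iff_union.1 hst
    rw [this, probReal_univ]
  have h3 := measureReal_union_le (μ := μ) s t
  linarith

end SelfNormalized

end TargetedExploration

end

/-- The σ-algebra `𝓕 k` is the information available just before the disturbance `w k` acts: the
regressor `φ_k` is `𝓕 k`-measurable and `w k` is `𝓕 (k + 1)`-measurable. -/
theorem proposition1 {Ω : Type*} [mΩ : MeasurableSpace Ω] (μ : MeasureTheory.Measure Ω)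
    [MeasureTheory.IsProbabilityMeasure μ] (𝓕 : MeasureTheory.Filtration ℕ mΩ)
    (nx nu : ℕ) (A : Matrix (Fin nx) (Fin nx) ℝ) (B : Matrix (Fin nx) (Fin nu) ℝ)
    (x : ℕ → Ω → Fin nx → ℝ) (u : ℕ → Ω → Fin nu → ℝ) (w : ℕ → Ω → Fin nx → ℝ)
    (hx_zero : ∀ ω, x 0 ω = 0)
    (hx_succ : ∀ k ω, x (k + 1) ω = A *ᵥ x k ω + B *ᵥ u k ω + w k ω)
    (hφ : ∀ k, Measurable[𝓕 k] fun ω => TargetedExploration.phi (x k ω) (u k ω))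
    (hw : ∀ k, Measurable[𝓕 (k + 1)] (w k))
    (σ : ℝ) (hσ : 0 ≤ σ)
    (hsubG : ∀ k, TargetedExploration.IsCondSubGaussian (𝓕 k) μ (w k) 0
      (σ ^ 2 • (1 : Matrix (Fin nx) (Fin nx) ℝ)))
    (θhat₀ : TargetedExploration.ThetaIdx nx nu → ℝ)
    (D₀ : Matrix (TargetedExploration.PhiIdx nx nu) (TargetedExploration.PhiIdx nx nu) ℝ)
    (hD₀ : D₀.PosDef)
    (hprior : TargetedExploration.param A B ∈ TargetedExploration.priorSet θhat₀ D₀)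
    (Ddes : Matrix (TargetedExploration.PhiIdx nx nu) (TargetedExploration.PhiIdx nx nu) ℝ)
    (hDdes : Ddes.PosDef)
    (lam : ℝ) (hlam : 0 < lam) (δ : ℝ) (hδ : 0 < δ) (T : ℕ) :
    (1 - δ ≤ μ.real {ω |
      TargetedExploration.SufficientCondition σ lam δ θhat₀ D₀ Ddes
          (TargetedExploration.dataMatrix (fun k => x k ω) (fun k => u k ω) T) →
        TargetedExploration.ExplorationGoal Ddes (TargetedExploration.param A B)
          (TargetedExploration.rlsEstimate lam (fun k => x k ω) (fun k => u k ω) T)}) ∧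
    ((∀ᵐ ω ∂μ, TargetedExploration.SufficientCondition σ lam δ θhat₀ D₀ Ddes
          (TargetedExploration.dataMatrix (fun k => x k ω) (fun k => u k ω) T)) →
      1 - δ ≤ μ.real {ω |
        TargetedExploration.ExplorationGoal Ddes (TargetedExploration.param A B)
          (TargetedExploration.rlsEstimate lam (fun k => x k ω) (fun k => u k ω) T)}) := by
  have main : 1 - δ ≤ μ.real {ω |
      TargetedExploration.SufficientCondition σ lam δ θhat₀ D₀ Ddes
          (TargetedExploration.dataMatrix (fun k => x k ω) (fun k => u k ω) T) →
        TargetedExploration.ExplorationGoal Ddes (TargetedExploration.param A B)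
          (TargetedExploration.rlsEstimate lam (fun k => x k ω) (fun k => u k ω) T)} := by
    -- The comparison of constants needs `log δ ≤ 0`; for `δ > 1` the claim is vacuous.
    rcases le_or_gt δ 1 with hδ1 | hδ1
    · refine TargetedExploration.one_sub_le_measureReal_of_compl_subset hδ.le
        (TargetedExploration.measure_lt_noiseTerm_le hφ hw hσ hsubG hlam hδ T) ?_
      intro ω hω hsuff
      simp only [Set.mem_compl_iff, Set.mem_ofPred_eq, not_lt] at hω
      exact TargetedExploration.explorationGoal_of_noiseTerm_le (w := fun k => w k ω)
        (fun k => hx_succ k ω) hlam hδ hδ1 hD₀ hprior hω hsuff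
    · exact (sub_nonpos.2 hδ1.le).trans MeasureTheory.measureReal_nonneg
  refine ⟨main, fun hsuff => main.trans_eq ?_⟩
  refine MeasureTheory.measureReal_congr ?_
  filter_upwards [hsuff] with ω hω
  exact propext ⟨fun h => h hω, fun h _ => h⟩
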